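/- Let $\mathbb{H}$ be the upper half plane. For even $k\ge 2$ and $z\in\mathbb{H}$ let \[ E_k(z)=1+\frac{2}{\zeta(1-k)}\sum_{n=1}^\infty\sum_{d\mid n}d^{k-1}e^{2\pi i n z}, \qquad \Delta=\frac{E_4^3-E_6^2}{1728}, \] \[ \Theta_{01}(z)=\sum_{n\in\mathbb{Z}}(-1)^n e^{\pi i n^2 z},\qquad \Theta_{10}(z)=\sum_{n\in\mathbb{Z}}e^{\pi i (n+1/2)^2 z}, \] and put \[ \varphi=\frac{(25E_4^4-49E_6^2E_4)+48E_6E_4^2E_2+(-49E_4^3+25E_6^2)E_2^2}{\Delta^2}, \] \[ \psi_I=\frac{7\Theta_{01}^{20}\Theta_{10}^8+7\Theta_{01}^{24}\Theta_{10}^4+2\Theta_{01}^{28}}{\Delta^2}. \] For real $t>0$ define \[ B(t)=\frac{\pi}{28304640}\,t^{10}\varphi(i/t)+\frac{1}{65520\pi}\,\psi_I(it). \] Then for all real $t\ge 1$ the number $B(t)$ is real and \[ B(t)>\frac{1}{39}\,t\,e^{2\pi t}-\frac{10}{117\pi}\,e^{2\pi t}. \] -/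

import Mathlib

namespace LeechB

open UpperHalfPlane

noncomputable section

/-- The normalized Eisenstein series `E₂` (quasimodular, weight 2). -/
def E2 (z : ℍ) : ℂ := EisensteinSeries.E2 z

/-- The normalized Eisenstein series `E₄` for `SL₂(ℤ)`. -/
def E4 (z : ℍ) : ℂ := ModularForm.E₄ z

/-- The normalized Eisenstein series `E₆` for `SL₂(ℤ)`. -/
def E6 (z : ℍ) : ℂ := ModularForm.E₆ z

/-- The divisor-sum expansion
`1 + (2 / ζ(1-k)) ∑_{n ≥ 1} ∑_{d ∣ n} d^(k-1) e^(2πinz)`.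
The lemmas below show that `E2`, `E4`, `E6` are the cases `k = 2, 4, 6`. -/
def eisensteinExpansion (k : ℕ) (z : ℍ) : ℂ :=
  1 + 2 / riemannZeta (1 - (k : ℂ)) *
    ∑' n : ℕ+, ∑ d ∈ (n : ℕ).divisors,
      (d : ℂ) ^ (k - 1) * Complex.exp (2 * Real.pi * Complex.I * (n : ℂ) * z)

theorem eisensteinExpansion_eq (k : ℕ) (z : ℍ) :
    eisensteinExpansion k z = 1 + 2 / riemannZeta (1 - (k : ℂ)) *
      ∑' n : ℕ+, (ArithmeticFunction.sigma (k - 1) n : ℂ) *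
        Complex.exp (2 * Real.pi * Complex.I * z) ^ (n : ℕ) := by
  unfold eisensteinExpansion
  congr 2
  refine tsum_congr fun n => ?_
  rw [ArithmeticFunction.sigma_apply, ← Complex.exp_nat_mul, ← Finset.sum_mul]
  push_cast
  congr 2
  ring

theorem E2_eq (z : ℍ) : E2 z = eisensteinExpansion 2 z := by
  rw [eisensteinExpansion_eq, E2, EisensteinSeries.E2_eq_tsum_cexp]
  have h := riemannZeta_neg_nat_eq_bernoulli 1
  have hb : bernoulli 2 = 1 / 6 := by
    rw [bernoulli_eq_bernoulli'_of_ne_one (by norm_num), bernoulli'_two]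
  norm_num [hb] at h
  norm_num [h]
  ring

theorem E4_eq (z : ℍ) : E4 z = eisensteinExpansion 4 z := by
  rw [eisensteinExpansion_eq, E4,
    EisensteinSeries.q_expansion_bernoulli (by norm_num) (by decide)]
  have h := riemannZeta_neg_nat_eq_bernoulli 3
  norm_num at h
  norm_num [h]
  ring

theorem E6_eq (z : ℍ) : E6 z = eisensteinExpansion 6 z := by
  rw [eisensteinExpansion_eq, E6,
    EisensteinSeries.q_expansion_bernoulli (by norm_num) (by decide)]
  have h := riemannZeta_neg_nat_eq_bernoulli 5
  norm_num at h
  norm_num [h]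
  ring

/-- `Δ = (E₄³ - E₆²) / 1728`. -/
def Delta (z : ℍ) : ℂ := (E4 z ^ 3 - E6 z ^ 2) / 1728

/-- The weakly holomorphic quasimodular form `φ` of weight `-8` and depth `2`. -/
def phi (z : ℍ) : ℂ :=
  ((25 * E4 z ^ 4 - 49 * E6 z ^ 2 * E4 z) + 48 * E6 z * E4 z ^ 2 * E2 z
    + (-49 * E4 z ^ 3 + 25 * E6 z ^ 2) * E2 z ^ 2) / Delta z ^ 2

/-- `Θ₀₁(z) = ∑_{n ∈ ℤ} (-1)ⁿ e^(πin²z)`. -/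
def Theta01 (z : ℍ) : ℂ :=
  ∑' n : ℤ, (-1 : ℂ) ^ n * Complex.exp (Real.pi * Complex.I * (n : ℂ) ^ 2 * z)

/-- `Θ₁₀(z) = ∑_{n ∈ ℤ} e^(πi(n+1/2)²z)`. -/
def Theta10 (z : ℍ) : ℂ :=
  ∑' n : ℤ, Complex.exp (Real.pi * Complex.I * ((n : ℂ) + 1 / 2) ^ 2 * z)

/-- The weakly holomorphic modular form `ψ_I` of weight `-10` for `Γ(2)`. -/
def psiI (z : ℍ) : ℂ :=
  (7 * Theta01 z ^ 20 * Theta10 z ^ 8 + 7 * Theta01 z ^ 24 * Theta10 z ^ 4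
    + 2 * Theta01 z ^ 28) / Delta z ^ 2

/-- The point `it` of the upper half plane, for real `t > 0`. -/
def imPoint (t : ℝ) (ht : 0 < t) : ℍ := ⟨Complex.I * (t : ℂ), by simpa using ht⟩

/-- `B(t) = (π / 28304640) t¹⁰ φ(i/t) + (1 / (65520 π)) ψ_I(it)`, for real `t > 0`. -/
def B (t : ℝ) (ht : 0 < t) : ℂ :=
  (Real.pi : ℂ) / 28304640 * (t : ℂ) ^ 10 * phi (imPoint (1 / t) (one_div_pos.mpr ht))
    + 1 / (65520 * (Real.pi : ℂ)) * psiI (imPoint t ht)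

end

end LeechB

/-! Put X = πt, r = e^(-πt), q = r². The transformation laws under z ↦ -1/z move everything to the
point it, where the q-series and theta series are real (`B_eq`): up to the positive factor 28304640
π Δ², B(t) equals X² N0 + 6X N1 + 36 N2 + 432 P. Here N0, N1, N2 are polynomials in E₂, E₄, E₆, and
P is the theta numerator. After clearing denominators, with d = E₄³ - E₆², the claim is q(X² N0 + 6X
N1 + 36 N2 + 432 P) > (35/144 X - 175/216) d².

The constants make all terms below q³ cancel: N0 has order q³, 6q N1 matches 35/144 d² through q²,
and q(36 N2 + 432 P) matches -175/216 d² through q². What remains is bounded below by q³(-4.1·10⁹ q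
X² + 1.13·10⁸ X - 2.3·10⁸) (`num0_bound`, `num1_bound`, `num2_bound`). This is positive for X ≥ 3.14
because rX stays small (`quadratic_in_X_pos`).

The three bounds replace each series by truncations with integer coefficients, so they reduce to
positivity of integer polynomials on [0, 1/529] in q or [0, 1/23] in r, where 23 ≤ e^3.14. -/

namespace LeechB

/-! ### Integer polynomials and a computable lower bound -/

/-- The value at `x` of the integer polynomial with coefficient list `l` (constant term first). -/
def polyEval : List ℤ → ℝ → ℝ
  | [], _ => 0
  | a :: l, x => a + x * polyEval l x

def polyAdd : List ℤ → List ℤ → List ℤ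
  | [], m => m
  | a :: l, [] => a :: l
  | a :: l, b :: m => (a + b) :: polyAdd l m

def polySmul (c : ℤ) : List ℤ → List ℤ
  | [] => []
  | a :: l => (c * a) :: polySmul c l

def polyMul : List ℤ → List ℤ → List ℤ
  | [], _ => []
  | a :: l, m => polyAdd (polySmul a m) (0 :: polyMul l m)

def polyPow (l : List ℤ) : ℕ → List ℤ
  | 0 => [1]
  | n + 1 => polyMul (polyPow l n) l

/-- A lower bound for `polyEval l` on the interval `[0, 1 / m]`, computed by a Horner scheme. -/
def polyLow (m : ℤ) : List ℤ → ℤ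
  | [] => 0
  | a :: l => a + min 0 (polyLow m l / m)

theorem polyEval_add (l m : List ℤ) (x : ℝ) :
    polyEval (polyAdd l m) x = polyEval l x + polyEval m x := by
  induction l generalizing m with
  | nil => simp [polyAdd, polyEval]
  | cons a l ih =>
    cases m with
    | nil => simp [polyAdd, polyEval]
    | cons b m =>
      simp only [polyAdd, polyEval, ih]
      push_cast
      ring

theorem polyEval_smul (c : ℤ) (l : List ℤ) (x : ℝ) :
    polyEval (polySmul c l) x = c * polyEval l x := by
  induction l with
  | nil => simp [polySmul, polyEval]
  | cons a l ih =>
    simp only [polySmul, polyEval, ih]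
    push_cast
    ring

theorem polyEval_mul (l m : List ℤ) (x : ℝ) :
    polyEval (polyMul l m) x = polyEval l x * polyEval m x := by
  induction l with
  | nil => simp [polyMul, polyEval]
  | cons a l ih =>
    simp only [polyMul, polyEval, polyEval_add, polyEval_smul, ih]
    push_cast
    ring

theorem polyEval_pow (l : List ℤ) (n : ℕ) (x : ℝ) :
    polyEval (polyPow l n) x = polyEval l x ^ n := by
  induction n with
  | zero => simp [polyPow, polyEval]
  | succ n ih => rw [polyPow, polyEval_mul, ih, pow_succ]

/-- A linear function x ↦ xL on [0, 1/m] is smallest at an endpoint, hence at least min(0, L/m).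
Rounding down keeps the scheme in the integers, so that positivity can be decided by evaluation. -/
theorem polyLow_le_polyEval {m : ℤ} (hm : 0 < m) (l : List ℤ) {x : ℝ} (hx : 0 ≤ x)
    (hxm : m * x ≤ 1) : (polyLow m l : ℝ) ≤ polyEval l x := by
  have hm' : (0 : ℝ) < m := by exact_mod_cast hm
  induction l with
  | nil => simp [polyLow, polyEval]
  | cons a l ih =>
    simp only [polyLow, polyEval]
    push_cast
    gcongr
    set L := polyLow m l
    rcases le_total 0 L with h | h
    · refine (min_le_left _ _).trans (mul_nonneg hx (le_trans ?_ ih))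
      exact_mod_cast h
    · refine (min_le_right _ _).trans ?_
      have h1 : ((L / m : ℤ) : ℝ) * m ≤ L := by exact_mod_cast Int.ediv_mul_le L hm.ne'
      have h2 : ((L / m : ℤ) : ℝ) ≤ 0 := by
        have h3 : (L : ℝ) ≤ 0 := by exact_mod_cast h
        by_contra h4
        nlinarith
      calc ((L / m : ℤ) : ℝ) ≤ ((L / m : ℤ) : ℝ) * (m * x) := by nlinarith
        _ ≤ x * L := by nlinarith
        _ ≤ x * polyEval l x := by gcongr

theorem polyEval_nonneg {m : ℤ} (hm : 0 < m) (l : List ℤ) (hl : 0 ≤ polyLow m l) {x : ℝ}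
    (hx : 0 ≤ x) (hxm : m * x ≤ 1) : 0 ≤ polyEval l x :=
  le_trans (by exact_mod_cast hl) (polyLow_le_polyEval hm l hx hxm)

/-- Coefficients of the polynomial obtained from `l` by the substitution `x ↦ x ^ 2`. -/
def polyDouble : List ℤ → List ℤ
  | [] => []
  | a :: l => a :: 0 :: polyDouble l

theorem polyEval_double (l : List ℤ) (x : ℝ) :
    polyEval (polyDouble l) x = polyEval l (x ^ 2) := by
  induction l with
  | nil => simp [polyDouble, polyEval]
  | cons a l ih =>
    simp only [polyDouble, polyEval, ih]
    push_cast
    ring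

/-! Polynomial bounds for `∑ σ_k(n) qⁿ` with `k = 1, 3, 5`, and for `E₂`, `E₄`, `E₆²`,
`E₄³ - E₆²` in terms of them; valid for `0 ≤ q ≤ 1 / 529`. -/

def sigmaLow1 : List ℤ := [0, 1, 3, 4]
def sigmaUp1 : List ℤ := [0, 1, 3, 4, 17]
def sigmaLow3 : List ℤ := [0, 1, 9, 28]
def sigmaUp3 : List ℤ := [0, 1, 9, 28, 258]
def sigmaLow5 : List ℤ := [0, 1, 33, 244]
def sigmaUp5 : List ℤ := [0, 1, 33, 244, 4128]

def lowE2 : List ℤ := polyAdd [1] (polySmul (-24) sigmaUp1)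
def upE2 : List ℤ := polyAdd [1] (polySmul (-24) sigmaLow1)
def lowE4 : List ℤ := polyAdd [1] (polySmul 240 sigmaLow3)
def upE4 : List ℤ := polyAdd [1] (polySmul 240 sigmaUp3)
def lowE6Sq : List ℤ := polyAdd [1]
  (polyAdd (polySmul (-1008) sigmaUp5) (polySmul (504 ^ 2) (polyPow sigmaLow5 2)))
def upE6Sq : List ℤ := polyAdd [1]
  (polyAdd (polySmul (-1008) sigmaLow5) (polySmul (504 ^ 2) (polyPow sigmaUp5 2)))
def lowDisc : List ℤ := polyAdd (polyPow lowE4 3) (polySmul (-1) upE6Sq)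
def upDisc : List ℤ := polyAdd (polyPow upE4 3) (polySmul (-1) lowE6Sq)

/-- Each monomial gets upper or lower bounds of its factors according to its sign. The factor E₆ = 1
- 504 s5 of odd degree is split first, whence 24192 = 48 · 504. -/
def lowNum0 : List ℤ :=
  polyAdd (polySmul 25 (polyPow lowE4 4)) <|
  polyAdd (polySmul (-49) (polyMul upE6Sq upE4)) <|
  polyAdd (polySmul 48 (polyMul (polyPow lowE4 2) lowE2)) <|
  polyAdd (polySmul (-24192) (polyMul sigmaUp5 (polyMul (polyPow upE4 2) upE2))) <|
  polyAdd (polySmul (-49) (polyMul (polyPow upE4 3) (polyPow upE2 2)))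
    (polySmul 25 (polyMul lowE6Sq (polyPow lowE2 2)))

def lowNum1 : List ℤ :=
  polyAdd (polySmul (-48) (polyPow upE4 2)) <|
  polyAdd (polySmul 24192 (polyMul sigmaLow5 (polyPow lowE4 2))) <|
  polyAdd (polySmul 98 (polyMul lowE2 (polyPow lowE4 3)))
    (polySmul (-50) (polyMul upE2 upE6Sq))

def lowNum2 : List ℤ := polyAdd (polySmul (-49) (polyPow upE4 3)) (polySmul 25 lowE6Sq)

def lowTheta01 : List ℤ := [1, -2, 0, 0, 2, 0, 0, 0, 0, -3]
-- The fourth power of Θ₀₁ cut before its term +96 r⁶, which keeps degrees low in the powers 5, 6,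
-- 7.
def lowTheta01Pow4 : List ℤ := [1, -8, 24, -32, 24, -48]
def lowTheta10Pow4 : List ℤ := polySmul 16 (polyMul [0, 1] (polyPow [1, 0, 1] 4))
def lowPsi : List ℤ :=
  polyAdd (polySmul 7 (polyMul (polyPow lowTheta01Pow4 5) (polyPow lowTheta10Pow4 2))) <|
  polyAdd (polySmul 7 (polyMul (polyPow lowTheta01Pow4 6) lowTheta10Pow4))
    (polySmul 2 (polyPow lowTheta01Pow4 7))

/-! ### Positivity certificates -/

theorem lowE2_nonneg {q : ℝ} (h0 : 0 ≤ q) (h1 : 529 * q ≤ 1) : 0 ≤ polyEval lowE2 q :=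
  polyEval_nonneg (m := 529) (by norm_num) _ (by decide +kernel) h0 (by exact_mod_cast h1)

theorem lowE4_nonneg {q : ℝ} (h0 : 0 ≤ q) (h1 : 529 * q ≤ 1) : 0 ≤ polyEval lowE4 q :=
  polyEval_nonneg (m := 529) (by norm_num) _ (by decide +kernel) h0 (by exact_mod_cast h1)

theorem sigmaLow5_nonneg {q : ℝ} (h0 : 0 ≤ q) (h1 : 529 * q ≤ 1) : 0 ≤ polyEval sigmaLow5 q :=
  polyEval_nonneg (m := 529) (by norm_num) _ (by decide +kernel) h0 (by exact_mod_cast h1)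

theorem le_lowDisc {q : ℝ} (h0 : 0 ≤ q) (h1 : 529 * q ≤ 1) : 1000 * q ≤ polyEval lowDisc q := by
  have := polyEval_nonneg (m := 529) (by norm_num) (polyAdd lowDisc [0, -1000])
    (by decide +kernel) h0 (by exact_mod_cast h1)
  simp [polyEval_add, polyEval] at this
  linarith

theorem lowNum0_bound {q : ℝ} (h0 : 0 ≤ q) (h1 : 529 * q ≤ 1) :
    -4100000000 * q ^ 3 ≤ polyEval lowNum0 q := by
  have := polyEval_nonneg (m := 529) (by norm_num) (polyAdd lowNum0 [0, 0, 0, 4100000000])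
    (by decide +kernel) h0 (by exact_mod_cast h1)
  simp [polyEval_add, polyEval] at this
  linarith

/-- Both sides of the difference begin with 725760 q² = 35/144 · 1728² q², so it starts at q³. -/
theorem lowNum1_bound {q : ℝ} (h0 : 0 ≤ q) (h1 : 529 * q ≤ 1) :
    113000000 * q ^ 3 ≤ 6 * q * polyEval lowNum1 q - 35 / 144 * polyEval upDisc q ^ 2 := by
  have := polyEval_nonneg (m := 529) (by norm_num)
    -- The inequality is multiplied by 144 to have integer coefficients.
    (polyAdd (polyMul [0, 864] lowNum1) <|
      polyAdd (polySmul (-35) (polyPow upDisc 2)) [0, 0, 0, -16272000000])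
    (by decide +kernel) h0 (by exact_mod_cast h1)
  simp [polyEval_add, polyEval_mul, polyEval_smul, polyEval_pow, polyEval] at this
  linarith

/-- The constant terms cancel, 36(-49 + 25) + 432 · 2 = 0, and the next terms are absorbed by d².
The variable is r because the theta series contain odd powers of it. -/
theorem lowNum2_bound {r : ℝ} (h0 : 0 ≤ r) (h1 : 23 * r ≤ 1) :
    -230000000 * (r ^ 2) ^ 3 ≤ r ^ 2 * (36 * polyEval lowNum2 (r ^ 2) + 432 * polyEval lowPsi r)
      + 175 / 216 * polyEval lowDisc (r ^ 2) ^ 2 := by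
  have := polyEval_nonneg (m := 23) (by norm_num)
    -- Denominators are cleared by the factor 216.
    (polyAdd (polyMul [0, 0, 216] <| polyAdd (polySmul 36 (polyDouble lowNum2))
        (polySmul 432 lowPsi)) <|
      polyAdd (polySmul 175 (polyDouble (polyPow lowDisc 2))) [0, 0, 0, 0, 0, 0, 49680000000])
    (by decide +kernel) h0 (by exact_mod_cast h1)
  simp [polyEval_add, polyEval_mul, polyEval_smul, polyEval_pow, polyEval_double,
    polyEval] at this
  linarith

theorem lowTheta01Pow4_nonneg {r : ℝ} (h0 : 0 ≤ r) (h1 : 23 * r ≤ 1) :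
    0 ≤ polyEval lowTheta01Pow4 r :=
  polyEval_nonneg (m := 23) (by norm_num) _ (by decide +kernel) h0 (by exact_mod_cast h1)

theorem lowTheta10Pow4_nonneg {r : ℝ} (h0 : 0 ≤ r) (h1 : 23 * r ≤ 1) :
    0 ≤ polyEval lowTheta10Pow4 r :=
  polyEval_nonneg (m := 23) (by norm_num) _ (by decide +kernel) h0 (by exact_mod_cast h1)

theorem lowTheta01_nonneg {r : ℝ} (h0 : 0 ≤ r) (h1 : 23 * r ≤ 1) :
    0 ≤ polyEval lowTheta01 r :=
  polyEval_nonneg (m := 23) (by norm_num) _ (by decide +kernel) h0 (by exact_mod_cast h1)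

theorem lowTheta01Pow4_le {r : ℝ} (h0 : 0 ≤ r) (h1 : 23 * r ≤ 1) :
    polyEval lowTheta01Pow4 r ≤ polyEval lowTheta01 r ^ 4 := by
  have := polyEval_nonneg (m := 23) (by norm_num)
    (polyAdd (polyPow lowTheta01 4) (polySmul (-1) lowTheta01Pow4))
    (by decide +kernel) h0 (by exact_mod_cast h1)
  simp [polyEval_add, polyEval_smul, polyEval_pow] at this
  linarith

/-! ### From the series to their polynomial bounds -/

/-- Two-sided bounds on the divisor sums `s1`, `s3`, `s5` of exponents `1`, `3`, `5` at `q`. -/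
structure SigmaBounds (q s1 s3 s5 : ℝ) : Prop where
  nonneg : 0 ≤ q
  small : 529 * q ≤ 1
  low1 : polyEval sigmaLow1 q ≤ s1
  up1 : s1 ≤ polyEval sigmaUp1 q
  low3 : polyEval sigmaLow3 q ≤ s3
  up3 : s3 ≤ polyEval sigmaUp3 q
  low5 : polyEval sigmaLow5 q ≤ s5
  up5 : s5 ≤ polyEval sigmaUp5 q

namespace SigmaBounds

variable {q s1 s3 s5 : ℝ}

theorem lowE2_le (h : SigmaBounds q s1 s3 s5) : polyEval lowE2 q ≤ 1 - 24 * s1 := by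
  have := h.up1
  simp only [lowE2, polyEval_add, polyEval_smul, polyEval]
  push_cast
  linarith

theorem le_upE2 (h : SigmaBounds q s1 s3 s5) : 1 - 24 * s1 ≤ polyEval upE2 q := by
  have := h.low1
  simp only [upE2, polyEval_add, polyEval_smul, polyEval]
  push_cast
  linarith

theorem lowE4_le (h : SigmaBounds q s1 s3 s5) : polyEval lowE4 q ≤ 1 + 240 * s3 := by
  have := h.low3
  simp only [lowE4, polyEval_add, polyEval_smul, polyEval]
  push_cast
  linarith

theorem le_upE4 (h : SigmaBounds q s1 s3 s5) : 1 + 240 * s3 ≤ polyEval upE4 q := by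
  have := h.up3
  simp only [upE4, polyEval_add, polyEval_smul, polyEval]
  push_cast
  linarith

theorem lowE6Sq_le (h : SigmaBounds q s1 s3 s5) :
    polyEval lowE6Sq q ≤ (1 - 504 * s5) ^ 2 := by
  have h5 := sigmaLow5_nonneg h.nonneg h.small
  have h6 : polyEval sigmaLow5 q ^ 2 ≤ s5 ^ 2 := by gcongr; exact h.low5
  have := h.up5
  simp only [lowE6Sq, polyEval_add, polyEval_smul, polyEval_pow]
  simp only [polyEval]
  push_cast
  linarith

theorem le_upE6Sq (h : SigmaBounds q s1 s3 s5) :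
    (1 - 504 * s5) ^ 2 ≤ polyEval upE6Sq q := by
  have h5 := (sigmaLow5_nonneg h.nonneg h.small).trans h.low5
  have h6 : s5 ^ 2 ≤ polyEval sigmaUp5 q ^ 2 := by gcongr; exact h.up5
  have := h.low5
  simp only [upE6Sq, polyEval_add, polyEval_smul, polyEval_pow]
  simp only [polyEval]
  push_cast
  linarith

theorem lowDisc_le (h : SigmaBounds q s1 s3 s5) :
    polyEval lowDisc q ≤ (1 + 240 * s3) ^ 3 - (1 - 504 * s5) ^ 2 := by
  have h4 := lowE4_nonneg h.nonneg h.small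
  have h5 : polyEval lowE4 q ^ 3 ≤ (1 + 240 * s3) ^ 3 := by gcongr; exact h.lowE4_le
  have := h.le_upE6Sq
  simp only [lowDisc, polyEval_add, polyEval_smul, polyEval_pow]
  push_cast
  linarith

theorem le_upDisc (h : SigmaBounds q s1 s3 s5) :
    (1 + 240 * s3) ^ 3 - (1 - 504 * s5) ^ 2 ≤ polyEval upDisc q := by
  have h4 := (lowE4_nonneg h.nonneg h.small).trans h.lowE4_le
  have h5 : (1 + 240 * s3) ^ 3 ≤ polyEval upE4 q ^ 3 := by gcongr; exact h.le_upE4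
  have := h.lowE6Sq_le
  simp only [upDisc, polyEval_add, polyEval_smul, polyEval_pow]
  push_cast
  linarith

theorem num0_bound (h : SigmaBounds q s1 s3 s5) {a b c : ℝ} (ha : a = 1 - 24 * s1)
    (hb : b = 1 + 240 * s3) (hc : c = 1 - 504 * s5) :
    -4100000000 * q ^ 3 ≤ 25 * b ^ 4 - 49 * c ^ 2 * b + 48 * c * b ^ 2 * a
      + (-49 * b ^ 3 + 25 * c ^ 2) * a ^ 2 := by
  refine (lowNum0_bound h.nonneg h.small).trans ?_
  have ha0 := lowE2_nonneg h.nonneg h.small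
  have hb0 := lowE4_nonneg h.nonneg h.small
  have hs0 := (sigmaLow5_nonneg h.nonneg h.small).trans h.low5
  have ha1 : polyEval lowE2 q ≤ a := ha ▸ h.lowE2_le
  have ha2 : a ≤ polyEval upE2 q := ha ▸ h.le_upE2
  have hb1 : polyEval lowE4 q ≤ b := hb ▸ h.lowE4_le
  have hb2 : b ≤ polyEval upE4 q := hb ▸ h.le_upE4
  have hc1 : polyEval lowE6Sq q ≤ c ^ 2 := hc ▸ h.lowE6Sq_le
  have hc2 : c ^ 2 ≤ polyEval upE6Sq q := hc ▸ h.le_upE6Sq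
  have hc0 : 0 ≤ c ^ 2 := sq_nonneg c
  have hs := h.up5
  have ha3 := ha0.trans ha1
  have hb3 := hb0.trans hb1
  have hb4 := hb3.trans hb2
  have hca : 48 * c * b ^ 2 * a = 48 * (b ^ 2 * a) - 24192 * (s5 * (b ^ 2 * a)) := by
    rw [hc]; ring
  have t1 : polyEval lowE4 q ^ 4 ≤ b ^ 4 := by gcongr
  have t2 : c ^ 2 * b ≤ polyEval upE6Sq q * polyEval upE4 q :=
    mul_le_mul hc2 hb2 (hb0.trans hb1) (hc0.trans hc2)
  have t3 : polyEval lowE4 q ^ 2 * polyEval lowE2 q ≤ b ^ 2 * a := by gcongr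
  have t4 : s5 * (b ^ 2 * a) ≤ polyEval sigmaUp5 q * (polyEval upE4 q ^ 2 * polyEval upE2 q) := by
    have := hs0.trans hs
    gcongr
  have t5 : b ^ 3 * a ^ 2 ≤ polyEval upE4 q ^ 3 * polyEval upE2 q ^ 2 := by gcongr
  have t6 : polyEval lowE6Sq q * polyEval lowE2 q ^ 2 ≤ c ^ 2 * a ^ 2 :=
    (mul_le_mul_of_nonneg_right hc1 (sq_nonneg _)).trans (by gcongr)
  simp only [lowNum0, polyEval_add, polyEval_smul, polyEval_pow, polyEval_mul]
  push_cast
  rw [hca]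
  linarith

theorem num1_bound (h : SigmaBounds q s1 s3 s5) {a b c : ℝ} (ha : a = 1 - 24 * s1)
    (hb : b = 1 + 240 * s3) (hc : c = 1 - 504 * s5) :
    113000000 * q ^ 3 ≤ 6 * q * (-48 * c * b ^ 2 - 2 * (-49 * b ^ 3 + 25 * c ^ 2) * a)
      - 35 / 144 * (b ^ 3 - c ^ 2) ^ 2 := by
  refine (lowNum1_bound h.nonneg h.small).trans ?_
  have hq := h.nonneg
  have ha0 := lowE2_nonneg h.nonneg h.small
  have hb0 := lowE4_nonneg h.nonneg h.small
  have hs0 := sigmaLow5_nonneg h.nonneg h.small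
  have ha1 : polyEval lowE2 q ≤ a := ha ▸ h.lowE2_le
  have ha2 : a ≤ polyEval upE2 q := ha ▸ h.le_upE2
  have hb1 : polyEval lowE4 q ≤ b := hb ▸ h.lowE4_le
  have hb2 : b ≤ polyEval upE4 q := hb ▸ h.le_upE4
  have hc2 : c ^ 2 ≤ polyEval upE6Sq q := hc ▸ h.le_upE6Sq
  have hc0 : 0 ≤ c ^ 2 := sq_nonneg c
  have hs := h.low5
  have ha3 := ha0.trans ha1
  have hb3 := hb0.trans hb1
  have hd0 : 0 ≤ b ^ 3 - c ^ 2 := by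
    refine le_trans ?_ (hb ▸ hc ▸ h.lowDisc_le)
    linarith [le_lowDisc h.nonneg h.small]
  have hd1 : b ^ 3 - c ^ 2 ≤ polyEval upDisc q := hb ▸ hc ▸ h.le_upDisc
  have hcb : 48 * c * b ^ 2 = 48 * b ^ 2 - 24192 * (s5 * b ^ 2) := by rw [hc]; ring
  have t1 : b ^ 2 ≤ polyEval upE4 q ^ 2 := by gcongr
  have t2 : polyEval sigmaLow5 q * polyEval lowE4 q ^ 2 ≤ s5 * b ^ 2 := by
    have := hs0.trans hs
    gcongr
  have t3 : polyEval lowE2 q * polyEval lowE4 q ^ 3 ≤ a * b ^ 3 := by gcongr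
  have t4 : a * c ^ 2 ≤ polyEval upE2 q * polyEval upE6Sq q :=
    mul_le_mul ha2 hc2 hc0 (ha3.trans ha2)
  have t5 : polyEval lowNum1 q ≤ -48 * c * b ^ 2 - 2 * (-49 * b ^ 3 + 25 * c ^ 2) * a := by
    simp only [lowNum1, polyEval_add, polyEval_smul, polyEval_pow, polyEval_mul]
    push_cast
    linarith
  gcongr

theorem disc_pos (h : SigmaBounds q s1 s3 s5) (hq : 0 < q) :
    0 < (1 + 240 * s3) ^ 3 - (1 - 504 * s5) ^ 2 :=
  lt_of_lt_of_le (by linarith) ((le_lowDisc h.nonneg h.small).trans h.lowDisc_le)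

end SigmaBounds

theorem num2_bound {r s1 s3 s5 p x y : ℝ} (h : SigmaBounds (r ^ 2) s1 s3 s5) (hr : 0 ≤ r)
    (hr1 : 23 * r ≤ 1) {b c : ℝ} (hb : b = 1 + 240 * s3) (hc : c = 1 - 504 * s5)
    (hx : polyEval lowTheta01 r ≤ x) (hy : polyEval lowTheta10Pow4 r ≤ y)
    (hp : p = 7 * (x ^ 4) ^ 5 * y ^ 2 + 7 * (x ^ 4) ^ 6 * y + 2 * (x ^ 4) ^ 7) :
    -230000000 * (r ^ 2) ^ 3 ≤ r ^ 2 * (36 * (-49 * b ^ 3 + 25 * c ^ 2) + 432 * p)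
      + 175 / 216 * (b ^ 3 - c ^ 2) ^ 2 := by
  refine (lowNum2_bound hr hr1).trans ?_
  have hb0 := (lowE4_nonneg h.nonneg h.small).trans h.lowE4_le
  have hb2 : b ^ 3 ≤ polyEval upE4 (r ^ 2) ^ 3 := by
    rw [hb]; gcongr; exact h.le_upE4
  have hc1 : polyEval lowE6Sq (r ^ 2) ≤ c ^ 2 := hc ▸ h.lowE6Sq_le
  have hd0 : 0 ≤ polyEval lowDisc (r ^ 2) := by
    linarith [le_lowDisc h.nonneg h.small, h.nonneg]
  have hd1 : polyEval lowDisc (r ^ 2) ≤ b ^ 3 - c ^ 2 := hb ▸ hc ▸ h.lowDisc_le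
  have t1 : polyEval lowNum2 (r ^ 2) ≤ -49 * b ^ 3 + 25 * c ^ 2 := by
    simp only [lowNum2, polyEval_add, polyEval_smul, polyEval_pow]
    push_cast
    linarith
  have hu0 := lowTheta01Pow4_nonneg hr hr1
  have hx0 := lowTheta01_nonneg hr hr1
  have hy0 := lowTheta10Pow4_nonneg hr hr1
  have hu : polyEval lowTheta01Pow4 r ≤ x ^ 4 :=
    (lowTheta01Pow4_le hr hr1).trans (by gcongr)
  have t2 : polyEval lowPsi r ≤ p := by
    simp only [lowPsi, polyEval_add, polyEval_smul, polyEval_pow, polyEval_mul]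
    push_cast
    rw [hp, mul_assoc, mul_assoc, ← add_assoc]
    gcongr
  gcongr

/-! ### Tails of the divisor sums and theta series -/

open ArithmeticFunction

/-- Since σ_k(m) ≤ m^(k+1), and for m ≥ 4 passing from m to m + 1 multiplies this power by at most
(5/4)⁶ < 4, the growth is dominated by a geometric sequence. -/
theorem sigma_add_four_le {k : ℕ} (hk : k ≤ 5) (n : ℕ) :
    (sigma k (n + 4) : ℝ) ≤ 4 ^ (k + 1) * 4 ^ n := by
  have h1 : (sigma k (n + 4) : ℝ) ≤ ((n + 4 : ℕ) : ℝ) ^ (k + 1) := by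
    exact_mod_cast sigma_le_pow_succ k (n + 4)
  refine h1.trans ?_
  clear h1
  induction n with
  | zero => simp
  | succ n ih =>
    have h2 : ((n + 1 + 4 : ℕ) : ℝ) ≤ 5 / 4 * ((n + 4 : ℕ) : ℝ) := by
      push_cast
      linarith [(Nat.cast_nonneg n : (0 : ℝ) ≤ n)]
    have h3 : (5 / 4 : ℝ) ^ (k + 1) ≤ 4 :=
      (pow_le_pow_right₀ (by norm_num) (by omega : k + 1 ≤ 6)).trans (by norm_num)
    calc ((n + 1 + 4 : ℕ) : ℝ) ^ (k + 1) ≤ (5 / 4 * ((n + 4 : ℕ) : ℝ)) ^ (k + 1) := by gcongr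
      _ = (5 / 4) ^ (k + 1) * ((n + 4 : ℕ) : ℝ) ^ (k + 1) := mul_pow _ _ _
      _ ≤ 4 * (4 ^ (k + 1) * 4 ^ n) := by gcongr
      _ = 4 ^ (k + 1) * 4 ^ (n + 1) := by ring

theorem sigma_tsum_bounds {k : ℕ} (hk : k ≤ 5) {q : ℝ} (h0 : 0 ≤ q) (h1 : 529 * q ≤ 1) :
    q + sigma k 2 * q ^ 2 + sigma k 3 * q ^ 3 ≤ ∑' n : ℕ+, (sigma k n : ℝ) * q ^ (n : ℕ) ∧
    ∑' n : ℕ+, (sigma k n : ℝ) * q ^ (n : ℕ) ≤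
      q + sigma k 2 * q ^ 2 + sigma k 3 * q ^ 3 + 129 / 128 * 4 ^ (k + 1) * q ^ 4 := by
  have hgeo : HasSum (fun n : ℕ => 4 ^ (k + 1) * q ^ 4 * (4 * q) ^ n)
      (4 ^ (k + 1) * q ^ 4 * (1 - 4 * q)⁻¹) :=
    (hasSum_geometric_of_lt_one (by linarith) (by linarith)).mul_left _
  have hle : ∀ n : ℕ, (sigma k (n + 4) : ℝ) * q ^ (n + 4) ≤
      4 ^ (k + 1) * q ^ 4 * (4 * q) ^ n := fun n => by
    calc (sigma k (n + 4) : ℝ) * q ^ (n + 4) ≤ 4 ^ (k + 1) * 4 ^ n * q ^ (n + 4) := by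
          gcongr
          exact sigma_add_four_le hk n
      _ = _ := by ring
  have hnn : ∀ n : ℕ, 0 ≤ (sigma k (n + 4) : ℝ) * q ^ (n + 4) := fun n => by positivity
  have htail : Summable fun n : ℕ => (sigma k (n + 4) : ℝ) * q ^ (n + 4) :=
    hgeo.summable.of_nonneg_of_le hnn hle
  have hsum : Summable fun n : ℕ => (sigma k (n + 1) : ℝ) * q ^ (n + 1) :=
    (summable_nat_add_iff (f := fun n : ℕ => (sigma k (n + 1) : ℝ) * q ^ (n + 1)) 3).mp htail
  rw [tsum_pnat_eq_tsum_succ (f := fun n : ℕ => (sigma k n : ℝ) * q ^ n),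
    ← hsum.sum_add_tsum_nat_add 3]
  have hsplit : ∑ n ∈ Finset.range 3, (sigma k (n + 1) : ℝ) * q ^ (n + 1) =
      q + sigma k 2 * q ^ 2 + sigma k 3 * q ^ 3 := by
    simp [Finset.sum_range_succ]
  rw [hsplit]
  -- With 129/128 the tail coefficients 129/128 · 4^(k+1) are 258 and 4128 for k = 3, 5, and below
  -- 17 for k = 1.
  have hinv : (1 - 4 * q)⁻¹ ≤ 129 / 128 := by
    rw [inv_le_comm₀ (by linarith) (by norm_num)]
    linarith
  refine ⟨le_add_of_nonneg_right (tsum_nonneg hnn), ?_⟩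
  gcongr
  refine (htail.tsum_le_tsum hle hgeo.summable).trans ?_
  rw [hgeo.tsum_eq]
  calc 4 ^ (k + 1) * q ^ 4 * (1 - 4 * q)⁻¹ ≤ 4 ^ (k + 1) * q ^ 4 * (129 / 128) := by gcongr
    _ = 129 / 128 * 4 ^ (k + 1) * q ^ 4 := by ring

theorem sigmaBounds {q : ℝ} (h0 : 0 ≤ q) (h1 : 529 * q ≤ 1) :
    SigmaBounds q (∑' n : ℕ+, (sigma 1 n : ℝ) * q ^ (n : ℕ))
      (∑' n : ℕ+, (sigma 3 n : ℝ) * q ^ (n : ℕ)) (∑' n : ℕ+, (sigma 5 n : ℝ) * q ^ (n : ℕ)) := by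
  have e12 : sigma 1 2 = 3 := by decide +kernel
  have e13 : sigma 1 3 = 4 := by decide +kernel
  have e32 : sigma 3 2 = 9 := by decide +kernel
  have e33 : sigma 3 3 = 28 := by decide +kernel
  have e52 : sigma 5 2 = 33 := by decide +kernel
  have e53 : sigma 5 3 = 244 := by decide +kernel
  obtain ⟨a1, b1⟩ := sigma_tsum_bounds (k := 1) (by norm_num) h0 h1
  obtain ⟨a3, b3⟩ := sigma_tsum_bounds (k := 3) (by norm_num) h0 h1
  obtain ⟨a5, b5⟩ := sigma_tsum_bounds (k := 5) (by norm_num) h0 h1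
  rw [e12, e13] at a1 b1
  rw [e32, e33] at a3 b3
  rw [e52, e53] at a5 b5
  have hq4 : 0 ≤ q ^ 4 := by positivity
  push_cast at a1 b1 a3 b3 a5 b5
  constructor <;> first | assumption | skip
  all_goals
    simp only [sigmaLow1, sigmaUp1, sigmaLow3, sigmaUp3, sigmaLow5, sigmaUp5, polyEval]
    push_cast
    linarith

theorem theta01_series_bound {r : ℝ} (h0 : 0 ≤ r) (h1 : 23 * r ≤ 1) :
    polyEval lowTheta01 r ≤ ∑' n : ℤ, (-1 : ℝ) ^ n * r ^ (n.natAbs ^ 2) := by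
  set a : ℕ → ℝ := fun n => (-1) ^ n * r ^ (n ^ 2) with ha
  have hgeo : HasSum (fun n : ℕ => r ^ 9 * r ^ n) (r ^ 9 * (1 - r)⁻¹) :=
    (hasSum_geometric_of_lt_one h0 (by linarith)).mul_left _
  have hle : ∀ n : ℕ, |a (n + 3)| ≤ r ^ 9 * r ^ n := fun n => by
    rw [ha, abs_mul, abs_pow, abs_neg, abs_one, one_pow, one_mul, abs_of_nonneg (by positivity),
      ← pow_add]
    exact pow_le_pow_of_le_one h0 (by linarith) (by nlinarith)
  have htail : Summable fun n => a (n + 3) := .of_norm_bounded hgeo.summable hle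
  have hsum : Summable a := (summable_nat_add_iff 3).mp htail
  have hsum1 : Summable fun n => a (n + 1) := (summable_nat_add_iff 1).mpr hsum
  have hinv : (1 - r)⁻¹ ≤ 3 / 2 := by
    rw [inv_le_comm₀ (by linarith) (by norm_num)]
    linarith
  -- This tail occurs for n ≥ 3 and again for n ≤ -3, which gives the coefficient -3 of r⁹ in
  -- `lowTheta01`.
  have hbound : -(3 / 2 * r ^ 9) ≤ ∑' n, a (n + 3) := by
    have h2 : -∑' n : ℕ, r ^ 9 * r ^ n ≤ ∑' n, a (n + 3) := by
      rw [← tsum_neg]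
      exact hgeo.summable.neg.tsum_le_tsum (fun n => (abs_le.mp (hle n)).1) htail
    rw [hgeo.tsum_eq] at h2
    have : r ^ 9 * (1 - r)⁻¹ ≤ r ^ 9 * (3 / 2) := by gcongr
    linarith
  have hneg : ∀ n : ℕ, (-1 : ℝ) ^ (-((n : ℤ) + 1)) * r ^ ((-((n : ℤ) + 1)).natAbs ^ 2) =
      a (n + 1) := fun n => by
    rw [Int.natAbs_neg, zpow_neg, ← inv_zpow, inv_neg_one, ← Int.natCast_succ, zpow_natCast,
      Int.natAbs_natCast]
  have hpos : ∀ n : ℕ, (-1 : ℝ) ^ (n : ℤ) * r ^ ((n : ℤ).natAbs ^ 2) = a n := fun n => by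
    simp [ha]
  rw [tsum_of_nat_of_neg_add_one (by simpa only [hpos] using hsum)
    (by simpa only [hneg] using hsum1)]
  simp only [hpos, hneg]
  have h3 := hsum.sum_add_tsum_nat_add 3
  have h4 := hsum.sum_add_tsum_nat_add 1
  simp [Finset.sum_range_succ, ha] at h3 h4
  simp only [ha] at hbound
  simp [lowTheta01, polyEval]
  linarith

/-- The symmetry n ↦ -n-1 doubles the sum over n ≥ 0. Keeping n = 0, 1 gives 2r^(1/4)(1 + r²), whose
fourth power is a polynomial in r. -/
theorem theta10_series_bound {t : ℝ} (ht : 0 < t) :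
    polyEval lowTheta10Pow4 (Real.exp (-(Real.pi * t))) ≤
      (∑' n : ℤ, Real.exp (-(Real.pi * t) * ((n : ℝ) + 1 / 2) ^ 2)) ^ 4 := by
  set f : ℤ → ℝ := fun n => Real.exp (-(Real.pi * t) * ((n : ℝ) + 1 / 2) ^ 2) with hf
  have hX : 0 < Real.pi * t := by positivity
  set r := Real.exp (-(Real.pi * t)) with hr
  set s := Real.exp (-(Real.pi * t) / 4) with hs
  have hrs : r = s ^ 4 := by
    rw [hr, hs, ← Real.exp_nat_mul]
    congr 1
    push_cast
    ring
  have hr1 : r < 1 := by rw [hr, Real.exp_lt_one_iff]; linarith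
  have hnat : Summable fun n : ℕ => f n := by
    refine .of_nonneg_of_le (fun n => (Real.exp_pos _).le) (fun n => ?_)
      (summable_geometric_of_lt_one (Real.exp_pos _).le hr1)
    rw [← Real.exp_nat_mul]
    refine Real.exp_le_exp.mpr ?_
    have : (n : ℝ) ≤ ((n : ℝ) + 1 / 2) ^ 2 := by nlinarith [sq_nonneg (n : ℝ)]
    push_cast
    nlinarith
  have hneg : ∀ n : ℕ, f (-((n : ℤ) + 1)) = f n := fun n => by
    simp only [hf]
    congr 1
    push_cast
    ring
  have htsum : ∑' n : ℤ, f n = 2 * ∑' n : ℕ, f n := by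
    rw [tsum_of_nat_of_neg_add_one hnat (by simpa only [hneg] using hnat)]
    simp only [hneg]
    ring
  have h2 : s + s ^ 9 ≤ ∑' n : ℕ, f n := by
    have := hnat.sum_le_tsum (Finset.range 2) (fun n _ => (Real.exp_pos _).le)
    refine le_trans (le_of_eq ?_) this
    rw [Finset.sum_range_succ, Finset.sum_range_one, hs, ← Real.exp_nat_mul]
    congr 2 <;> · push_cast; ring
  have hs0 : 0 < s := Real.exp_pos _
  rw [htsum]
  calc polyEval lowTheta10Pow4 r = (2 * (s + s ^ 9)) ^ 4 := by
        simp only [lowTheta10Pow4, polyEval_smul, polyEval_mul, polyEval_pow]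
        simp only [polyEval]
        rw [hrs]
        push_cast
        ring
    _ ≤ _ := by gcongr

/-! ### Transformation under z ↦ -1/z and values on the imaginary axis -/

open UpperHalfPlane hiding I
open Complex
open scoped ModularForm

theorem mk_neg_inv_imPoint {t : ℝ} (ht : 0 < t) :
    UpperHalfPlane.mk (-(imPoint t ht : ℂ))⁻¹ (imPoint t ht).im_inv_neg_coe_pos =
      imPoint (1 / t) (one_div_pos.mpr ht) := by
  ext
  have : (t : ℂ) ≠ 0 := by exact_mod_cast ht.ne'
  simp only [imPoint]
  push_cast
  field_simp
  simp

theorem slash_S {k : ℤ} (f : ModularForm (Matrix.SpecialLinearGroup.mapGL (n := Fin 2) (R := ℤ) ℝ).range k) :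
    (f : ℍ → ℂ) ∣[k] ModularGroup.S = f :=
  SlashInvariantForm.slash_action_eqn f _ ⟨ModularGroup.S, rfl⟩

theorem apply_imPoint_inv {t : ℝ} (ht : 0 < t) {k : ℤ} {f : ℍ → ℂ}
    (hf : f ∣[k] ModularGroup.S = f) :
    f (imPoint (1 / t) (one_div_pos.mpr ht)) = (I * t) ^ k * f (imPoint t ht) := by
  have h := congrFun hf (imPoint t ht)
  have hz : ((imPoint t ht : ℍ) : ℂ) = I * t := rfl
  have hI : (I * (t : ℂ)) ≠ 0 := mul_ne_zero I_ne_zero (by exact_mod_cast ht.ne')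
  rw [SlashInvariantForm.slash_S_apply, mk_neg_inv_imPoint, hz, zpow_neg, ← div_eq_mul_inv,
    div_eq_iff (zpow_ne_zero _ hI)] at h
  rw [h, mul_comm]

theorem E4_inv {t : ℝ} (ht : 0 < t) :
    E4 (imPoint (1 / t) (one_div_pos.mpr ht)) = t ^ 4 * E4 (imPoint t ht) := by
  rw [E4, E4, apply_imPoint_inv ht (slash_S ModularForm.E₄)]
  congr 1
  norm_cast
  rw [mul_pow, I_pow_four, one_mul]
  norm_cast

theorem E6_inv {t : ℝ} (ht : 0 < t) :
    E6 (imPoint (1 / t) (one_div_pos.mpr ht)) = -t ^ 6 * E6 (imPoint t ht) := by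
  rw [E6, E6, apply_imPoint_inv ht (slash_S ModularForm.E₆)]
  congr 1
  norm_cast
  rw [mul_pow, show (6 : ℕ) = 4 + 2 by rfl, pow_add I, I_pow_four, I_sq]
  push_cast
  ring

theorem E2_inv {t : ℝ} (ht : 0 < t) :
    E2 (imPoint (1 / t) (one_div_pos.mpr ht)) =
      -t ^ 2 * E2 (imPoint t ht) + 6 * t / Real.pi := by
  have h := congrFun (EisensteinSeries.E2_slash_action ModularGroup.S) (imPoint t ht)
  have ht0 : (t : ℂ) ≠ 0 := by exact_mod_cast ht.ne'
  have hpi : (Real.pi : ℂ) ≠ 0 := by exact_mod_cast Real.pi_ne_zero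
  rw [SlashInvariantForm.slash_S_apply, mk_neg_inv_imPoint] at h
  simp only [Pi.sub_apply, Pi.smul_apply, EisensteinSeries.D2_S, riemannZeta_two, smul_eq_mul] at h
  rw [E2, E2]
  have hz : ((imPoint t ht : ℍ) : ℂ) = I * t := rfl
  rw [hz] at h
  have hI : (I * (t : ℂ)) ≠ 0 := mul_ne_zero I_ne_zero ht0
  rw [zpow_neg, ← div_eq_mul_inv, div_eq_iff (zpow_ne_zero _ hI)] at h
  rw [h]
  have hI2 : I ^ 2 = -1 := I_sq
  norm_cast
  rw [mul_pow, hI2]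
  push_cast
  field_simp
  ring

theorem cexp_imPoint {t : ℝ} (ht : 0 < t) :
    cexp (2 * Real.pi * I * (imPoint t ht : ℂ)) = ((Real.exp (-(Real.pi * t)) ^ 2 : ℝ) : ℂ) := by
  rw [← Real.exp_nat_mul, ofReal_exp]
  congr 1
  simp only [imPoint]
  push_cast
  linear_combination (2 * Real.pi * t : ℂ) * I_sq

theorem sigma_tsum_imPoint {t : ℝ} (ht : 0 < t) (k : ℕ) :
    ∑' n : ℕ+, (ArithmeticFunction.sigma k n : ℂ) *
        cexp (2 * Real.pi * I * (imPoint t ht : ℂ)) ^ (n : ℕ) =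
      ((∑' n : ℕ+, (ArithmeticFunction.sigma k n : ℝ) *
        (Real.exp (-(Real.pi * t)) ^ 2) ^ (n : ℕ) : ℝ) : ℂ) := by
  rw [cexp_imPoint, ofReal_tsum]
  push_cast
  rfl

theorem E2_imPoint {t : ℝ} (ht : 0 < t) :
    E2 (imPoint t ht) = ((1 - 24 * ∑' n : ℕ+, (ArithmeticFunction.sigma 1 n : ℝ) *
        (Real.exp (-(Real.pi * t)) ^ 2) ^ (n : ℕ) : ℝ) : ℂ) := by
  rw [E2, EisensteinSeries.E2_eq_tsum_cexp, sigma_tsum_imPoint]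
  push_cast
  rfl

theorem E4_imPoint {t : ℝ} (ht : 0 < t) :
    E4 (imPoint t ht) = ((1 + 240 * ∑' n : ℕ+, (ArithmeticFunction.sigma 3 n : ℝ) *
        (Real.exp (-(Real.pi * t)) ^ 2) ^ (n : ℕ) : ℝ) : ℂ) := by
  rw [E4_eq, eisensteinExpansion_eq, sigma_tsum_imPoint]
  have h := riemannZeta_neg_nat_eq_bernoulli 3
  have hb : bernoulli 4 = -1 / 30 := by decide +kernel
  norm_num [hb] at h
  norm_num [h]

theorem E6_imPoint {t : ℝ} (ht : 0 < t) :
    E6 (imPoint t ht) = ((1 - 504 * ∑' n : ℕ+, (ArithmeticFunction.sigma 5 n : ℝ) *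
        (Real.exp (-(Real.pi * t)) ^ 2) ^ (n : ℕ) : ℝ) : ℂ) := by
  rw [E6_eq, eisensteinExpansion_eq, sigma_tsum_imPoint]
  have h := riemannZeta_neg_nat_eq_bernoulli 5
  have hb : bernoulli 6 = 1 / 42 := by decide +kernel
  norm_num [hb] at h
  norm_num [h]
  ring

theorem Theta01_imPoint {t : ℝ} (ht : 0 < t) :
    Theta01 (imPoint t ht) =
      ((∑' n : ℤ, (-1 : ℝ) ^ n * Real.exp (-(Real.pi * t)) ^ (n.natAbs ^ 2) : ℝ) : ℂ) := by
  rw [Theta01, ofReal_tsum]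
  refine tsum_congr fun n => ?_
  rw [← Real.exp_nat_mul]
  push_cast
  congr 2
  have h : (((n.natAbs : ℕ) : ℂ)) ^ 2 = (n : ℂ) ^ 2 := by
    rw [← Int.cast_natCast, ← Int.cast_pow, Int.natAbs_sq, Int.cast_pow]
  rw [h]
  simp only [imPoint]
  linear_combination (Real.pi * n ^ 2 * t : ℂ) * I_sq

theorem Theta10_imPoint {t : ℝ} (ht : 0 < t) :
    Theta10 (imPoint t ht) =
      ((∑' n : ℤ, Real.exp (-(Real.pi * t) * ((n : ℝ) + 1 / 2) ^ 2) : ℝ) : ℂ) := by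
  rw [Theta10, ofReal_tsum]
  refine tsum_congr fun n => ?_
  push_cast
  congr 1
  simp only [imPoint]
  linear_combination (Real.pi * ((n : ℂ) + 1 / 2) ^ 2 * t : ℂ) * I_sq

/-! ### The final inequality -/

/-- Combines e^3.14 ≥ 23 with e^y ≥ 1 + y at y = X - 3.14. -/
theorem exp_neg_le_inv {X : ℝ} (hX : 3.14 ≤ X) : 23 * Real.exp (-X) ≤ 1 / (X - 2.14) := by
  have h1 : 23 ≤ Real.exp 3.14 := by
    have h : Real.exp 3.14 = Real.exp 1 ^ 3 * Real.exp 0.14 := by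
      rw [← Real.exp_nat_mul, ← Real.exp_add]
      norm_num
    have h2 := Real.exp_one_gt_d9
    have h3 : (1.1498 : ℝ) ≤ Real.exp 0.14 := by
      have := Real.quadratic_le_exp_of_nonneg (x := 0.14) (by norm_num)
      norm_num at this ⊢
      linarith
    rw [h]
    calc (23 : ℝ) ≤ 2.7182818283 ^ 3 * 1.1498 := by norm_num
      _ ≤ _ := by gcongr
  have h2 : X - 2.14 ≤ Real.exp (X - 3.14) := by linarith [Real.add_one_le_exp (X - 3.14)]
  have h3 : Real.exp (-X) = (Real.exp 3.14 * Real.exp (X - 3.14))⁻¹ := by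
    rw [← Real.exp_add, ← Real.exp_neg]
    congr 1
    ring
  have hX' : 0 < X - 2.14 := by linarith
  rw [h3, ← div_eq_mul_inv, div_le_div_iff₀ (by positivity) hX', one_mul]
  gcongr

theorem quadratic_in_X_pos {X r : ℝ} (hX : 3.14 ≤ X) (hr : 0 ≤ r)
    (h : 23 * r ≤ 1 / (X - 2.14)) :
    0 < -4100000000 * (r ^ 2 * X ^ 2) + 113000000 * X - 230000000 := by
  have hX' : 0 < X - 2.14 := by linarith
  -- X/(X - 2.14) decreases and equals 3.14 at X = 3.14.
  have h1 : r * X ≤ 3.14 / 23 := by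
    rw [le_div_iff₀ hX'] at h
    nlinarith
  have h2 : (r * X) ^ 2 ≤ (3.14 / 23) ^ 2 := by gcongr
  rw [mul_pow] at h2
  norm_num at h2 hX ⊢
  linarith

/-- The term 6t/π in the law of E₂ produces the quadratic polynomial in πt; 432 = 28304640/65520
brings the theta part to the same denominator. -/
theorem B_eq {t : ℝ} (ht : 0 < t) {a b c x w : ℝ} (ha : E2 (imPoint t ht) = a)
    (hb : E4 (imPoint t ht) = b) (hc : E6 (imPoint t ht) = c)
    (hx : Theta01 (imPoint t ht) = x) (hw : Theta10 (imPoint t ht) = w)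
    (hd : 0 < b ^ 3 - c ^ 2) :
    B t ht = ((((Real.pi * t) ^ 2 * (25 * b ^ 4 - 49 * c ^ 2 * b + 48 * c * b ^ 2 * a
        + (-49 * b ^ 3 + 25 * c ^ 2) * a ^ 2)
      + 6 * (Real.pi * t) * (-48 * c * b ^ 2 - 2 * (-49 * b ^ 3 + 25 * c ^ 2) * a)
      + 36 * (-49 * b ^ 3 + 25 * c ^ 2)
      + 432 * (7 * (x ^ 4) ^ 5 * (w ^ 4) ^ 2 + 7 * (x ^ 4) ^ 6 * w ^ 4 + 2 * (x ^ 4) ^ 7)) /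
        (28304640 * Real.pi * ((b ^ 3 - c ^ 2) / 1728) ^ 2) : ℝ) : ℂ) := by
  have ht0 : (t : ℂ) ≠ 0 := by exact_mod_cast ht.ne'
  have hpi : (Real.pi : ℂ) ≠ 0 := by exact_mod_cast Real.pi_ne_zero
  have hd0 : (b ^ 3 - c ^ 2 : ℂ) ≠ 0 := by exact_mod_cast hd.ne'
  have hD : Delta (imPoint (1 / t) (one_div_pos.mpr ht)) =
      t ^ 12 * ((b ^ 3 - c ^ 2) / 1728) := by
    rw [Delta, E4_inv ht, E6_inv ht, hb, hc]
    ring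
  rw [B, phi, psiI, hD, Delta, E2_inv ht, E4_inv ht, E6_inv ht, ha, hb, hc, hx, hw]
  push_cast
  generalize hdd : (b ^ 3 - c ^ 2 : ℂ) = d at hd0
  field_simp
  ring

theorem im_eq_zero_and_lt_re_B {t : ℝ} (ht : 1 ≤ t) (ht0 : 0 < t) :
    (B t ht0).im = 0 ∧
      1 / 39 * t * Real.exp (2 * Real.pi * t)
          - 10 / (117 * Real.pi) * Real.exp (2 * Real.pi * t) < (B t ht0).re := by
  have hpi := Real.pi_gt_d2
  have hX : 3.14 ≤ Real.pi * t := by nlinarith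
  have hr0 : 0 < Real.exp (-(Real.pi * t)) := Real.exp_pos _
  have hrX := exp_neg_le_inv hX
  have hr1 : 23 * Real.exp (-(Real.pi * t)) ≤ 1 :=
    hrX.trans (by rw [div_le_one (by linarith)]; linarith)
  have hexp : Real.exp (2 * Real.pi * t) = (Real.exp (-(Real.pi * t)) ^ 2)⁻¹ := by
    rw [← Real.exp_nat_mul, ← Real.exp_neg]
    congr 1
    push_cast
    ring
  have hS := sigmaBounds (q := Real.exp (-(Real.pi * t)) ^ 2) (by positivity) (by nlinarith)
  have hd := hS.disc_pos (by positivity)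
  have hx := theta01_series_bound hr0.le hr1
  have hw := theta10_series_bound ht0
  have h0 := hS.num0_bound rfl rfl rfl
  have h1 := hS.num1_bound rfl rfl rfl
  have h2 := num2_bound hS hr0.le hr1 rfl rfl hx hw rfl
  have hpos := quadratic_in_X_pos hX hr0.le hrX
  rw [B_eq ht0 (E2_imPoint ht0) (E4_imPoint ht0) (E6_imPoint ht0) (Theta01_imPoint ht0)
    (Theta10_imPoint ht0) hd, hexp]
  refine ⟨Complex.ofReal_im _, ?_⟩
  rw [Complex.ofReal_re]
  generalize (1 - 24 * ∑' n : ℕ+, (ArithmeticFunction.sigma 1 n : ℝ) *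
        (Real.exp (-(Real.pi * t)) ^ 2) ^ (n : ℕ)) = a at *
  generalize (1 + 240 * ∑' n : ℕ+, (ArithmeticFunction.sigma 3 n : ℝ) *
        (Real.exp (-(Real.pi * t)) ^ 2) ^ (n : ℕ)) = b at *
  generalize (1 - 504 * ∑' n : ℕ+, (ArithmeticFunction.sigma 5 n : ℝ) *
        (Real.exp (-(Real.pi * t)) ^ 2) ^ (n : ℕ)) = c at *
  generalize 7 * (_ ^ 4) ^ 5 * (_ ^ 4) ^ 2 + 7 * (_ ^ 4) ^ 6 * _ ^ 4 + 2 * (_ ^ 4) ^ 7 = p at h2 ⊢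
  generalize 25 * b ^ 4 - 49 * c ^ 2 * b + 48 * c * b ^ 2 * a
      + (-49 * b ^ 3 + 25 * c ^ 2) * a ^ 2 = N0 at h0 ⊢
  generalize -48 * c * b ^ 2 - 2 * (-49 * b ^ 3 + 25 * c ^ 2) * a = N1 at h1 ⊢
  generalize -49 * b ^ 3 + 25 * c ^ 2 = N2 at h2 ⊢
  generalize b ^ 3 - c ^ 2 = d at *
  generalize Real.exp (-(Real.pi * t)) = r at *
  rw [lt_div_iff₀ (by positivity)]
  -- 35/144 = 28304640/(39 · 1728²) and 175/216 = 283046400/(117 · 1728²).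
  have hlhs : (1 / 39 * t * (r ^ 2)⁻¹ - 10 / (117 * Real.pi) * (r ^ 2)⁻¹) *
      (28304640 * Real.pi * (d / 1728) ^ 2) =
      (35 / 144 * (Real.pi * t) - 175 / 216) * d ^ 2 / r ^ 2 := by
    field_simp
    ring
  rw [hlhs, div_lt_iff₀ (by positivity)]
  generalize Real.pi * t = X at *
  have hX0 : 0 < X := by linarith
  -- The three bounds are added with weights qX², X and 1, where q = r².
  have k0 := mul_le_mul_of_nonneg_left h0 (by positivity : 0 ≤ r ^ 2 * X ^ 2)
  have k1 := mul_le_mul_of_nonneg_left h1 hX0.le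
  have k2 := mul_pos (by positivity : 0 < (r ^ 2) ^ 3) hpos
  linarith

end LeechB

theorem lemmaA3 (t : ℝ) (ht : 1 ≤ t) :
    (LeechB.B t (lt_of_lt_of_le one_pos ht)).im = 0 ∧
      1 / 39 * t * Real.exp (2 * Real.pi * t)
          - 10 / (117 * Real.pi) * Real.exp (2 * Real.pi * t)
        < (LeechB.B t (lt_of_lt_of_le one_pos ht)).re :=
  LeechB.im_eq_zero_and_lt_re_B ht _
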